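/- Let $(R,\mathfrak m)$ be a Cohen--Macaulay (Noetherian) local ring with infinite residue field and $\dim R\ge 2$. Assume that $R$ has minimal multiplicity, i.e. $e(R)=\mu(\mathfrak m)-\dim R+1$, where $e(R)$ is the Hilbert--Samuel multiplicity of $R$ and $\mu(\mathfrak m)$ is the minimal number of generators of $\mathfrak m$. Then, for every minimal reduction $I$ of $\mathfrak m$, $$\mathfrak d_3(I)=\mathrm r_I(\mathfrak m).$$ Here an ideal $I\subseteq\mathfrak m$ is a reduction of $\mathfrak m$ if $I\mathfrak m^r=\mathfrak m^{r+1}$ for some $r\ge 0$, it is a minimal reduction if it is minimal with respect to inclusion among the reductions of $\mathfrak m$, and $\mathrm r_I(\mathfrak m)=\min\{m\ge 0\mid I\mathfrak m^m=\mathfrak m^{m+1}\}$. Moreover $\mathfrak d_3(I)$ is the least $t\ge 0$ such that for all $k\ge t$ the ideal $I\mathfrak m^k$ is weakly $\mathfrak m$-full, i.e. $I\mathfrak m^{k+1}:\mathfrak m=I\mathfrak m^k$; part of the assertion is that such a $t$ exists. -/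

import Mathlib

namespace DaoNumbers

open IsLocalRing Filter Topology

/-- The ideal `I` is a reduction of the ideal `J`: `I ⊆ J` and `I J ^ r = J ^ (r + 1)` for some
integer `r ≥ 0`. -/
def IsReduction {R : Type*} [CommRing R] (I J : Ideal R) : Prop :=
  I ≤ J ∧ ∃ r : ℕ, I * J ^ r = J ^ (r + 1)

/-- The ideal `I` is a minimal reduction of `J`: it is minimal with respect to inclusion among the
reductions of `J`. -/
def IsMinimalReduction {R : Type*} [CommRing R] (I J : Ideal R) : Prop :=
  Minimal (fun L : Ideal R => IsReduction L J) I

/-- The reduction number `r_I(J)` of `J` with respect to a reduction `I`: the least `m ≥ 0` such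
that `I J ^ m = J ^ (m + 1)`. -/
noncomputable def reductionNumber {R : Type*} [CommRing R] (I J : Ideal R) : ℕ :=
  sInf {m : ℕ | I * J ^ m = J ^ (m + 1)}

section Local

variable {R : Type*} [CommRing R] [IsLocalRing R]

/-- An ideal `I` of a local ring `(R, 𝔪)` is weakly `𝔪`-full if `(I 𝔪 : 𝔪) = I`. -/
def IsWeaklyFull (I : Ideal R) : Prop :=
  (I * maximalIdeal R).colon (maximalIdeal R : Set R) = I

/-- The set of all `t ≥ 0` such that `I 𝔪 ^ k` is weakly `𝔪`-full for all `k ≥ t`. -/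
def thirdDaoSet (I : Ideal R) : Set ℕ :=
  {t : ℕ | ∀ k : ℕ, t ≤ k → IsWeaklyFull (I * maximalIdeal R ^ k)}

/-- The third Dao number `𝔡₃(I)`: the least `t ≥ 0` such that `I 𝔪 ^ k` is weakly `𝔪`-full for all
`k ≥ t`. -/
noncomputable def thirdDaoNumber (I : Ideal R) : ℕ :=
  sInf (thirdDaoSet I)

variable (R)

/-- The depth of a local ring `(R, 𝔪)`: the supremum of the lengths of the `R`-regular sequences
contained in `𝔪`. -/
noncomputable def depth : ℕ∞ :=
  ⨆ rs : {rs : List R // RingTheory.Sequence.IsRegular R rs ∧ ∀ r ∈ rs, r ∈ maximalIdeal R},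
    (rs.1.length : ℕ∞)

/-- A local ring is Cohen-Macaulay if it is Noetherian and its depth equals its Krull dimension. -/
def IsCohenMacaulayLocal : Prop :=
  IsNoetherianRing R ∧ (depth R : WithBot ℕ∞) = ringKrullDim R

/-- The (Hilbert-Samuel) multiplicity of the local ring `(R, 𝔪)` of Krull dimension `d` is `e`,
i.e. `e = lim_{n → ∞} d! ℓ(R / 𝔪 ^ n) / n ^ d`. -/
def HasMultiplicity (e : ℕ) : Prop :=
  ∃ d : ℕ, ringKrullDim R = d ∧
    Tendsto (fun n : ℕ =>
      ((d.factorial : ℝ) * ((Module.length R (R ⧸ maximalIdeal R ^ n)).toNat : ℝ)) / (n : ℝ) ^ d)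
      atTop (𝓝 (e : ℝ))

/-- A local ring `(R, 𝔪)` of Krull dimension `d`, embedding dimension `μ(𝔪)` and multiplicity `e`
has minimal multiplicity if `e = μ(𝔪) - d + 1` (written here without subtraction). -/
def HasMinimalMultiplicity : Prop :=
  ∃ d e : ℕ, ringKrullDim R = d ∧ HasMultiplicity R e ∧
    e + d = (maximalIdeal R).spanFinrank + 1

end Local

end DaoNumbers

/-!
Write `𝔪` for the maximal ideal of `R`, `d` for its dimension and `e` for its multiplicity.

Since the residue field is infinite and `R` has depth `d`, the minimal reduction `I` is generated
by a regular sequence `x₁, …, x_d` in which each `xᵢ` is superficial modulo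
`Jᵢ₋₁ = (x₁, …, xᵢ₋₁)`, in the sense that `(Jᵢ₋₁ + 𝔪 ^ (n + 1)) : xᵢ = Jᵢ₋₁ + 𝔪 ^ n` for large `n`
(`IsMinimalReduction.superficialSequence`). Such elements are found in `I` by avoiding finitely
many proper submodules, which come from associated primes in the Noetherian Rees algebra of `𝔪`
(`exists_finite_primes_superficial`); that the process goes on for `d` steps is the exchange
property of depth (`DepthAtLeast.sup_span_singleton`).

Superficiality turns the Hilbert function of `R ⧸ Jᵢ₋₁` into a sum of that of `R ⧸ Jᵢ`, up to
finitely many terms, and this gives `ℓ(R ⧸ I) ≤ e`. As `I` has `d` generators,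
`ℓ(R ⧸ I 𝔪) ≤ e + d = μ(𝔪) + 1 = ℓ(R ⧸ 𝔪 ^ 2)`, so `I 𝔪 = 𝔪 ^ 2` (`mul_maximalIdeal_eq_sq`). In
particular the reduction number is `0` or `1`, and it is `0` exactly when `I = 𝔪`.

The equality `I 𝔪 = 𝔪 ^ 2` implies `I ∩ 𝔪 ^ (n + 1) ⊆ I 𝔪 ^ n` for all `n`. As in the theorem of
Valabrega and Valla, this condition descends along the regular sequence to the ideal `(x₁)`
(`RegularModulo.inf_pow_le`), where it reads `𝔪 ^ (n + 1) : x₁ = 𝔪 ^ n`. Hence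
`𝔪 ^ (n + 1) : 𝔪 = 𝔪 ^ n` for all `n`. So `I 𝔪 ^ k = 𝔪 ^ (k + 1)` is weakly `𝔪`-full for all
`k ≥ 1`, while `I 𝔪 : 𝔪 = 𝔪 ^ 2 : 𝔪 = 𝔪` shows that `I` is weakly `𝔪`-full only if `I = 𝔪`
(`thirdDaoSet_eq`).

Residue rings `R ⧸ J` are handled through ideals `J` of the fixed ring `R`.
-/

namespace DaoNumbers

open IsLocalRing Filter Topology

/-! ### Avoidance over an infinite residue field, and regular elements modulo an ideal -/

section Avoidance

variable {R : Type*} [CommRing R]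

/-- A module over a local ring with infinite residue field is not a finite union of proper
submodules. By B. H. Neumann's lemma one of the submodules would have finite index, whereas every
nonzero module `M` is infinite: a nonzero cyclic submodule of `M` surjects onto the residue field.
-/
theorem exists_forall_notMem_of_infinite_residueField [IsLocalRing R] [Infinite (ResidueField R)]
    {N : Type*} [AddCommGroup N] [Module R N] {s : Set (Submodule R N)} (hs : s.Finite)
    (htop : ⊤ ∉ s) : ∃ x, ∀ p ∈ s, x ∉ p := by
  by_contra! hcov
  obtain ⟨p, hp, hfin⟩ := Submodule.exists_finiteIndex_of_cover
    (R := R) (M := N) (p := id) (s := hs.toFinset)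
    (by
      refine Set.eq_univ_of_forall fun x => ?_
      obtain ⟨p, hp, hx⟩ := hcov x
      simp only [Set.mem_iUnion]
      exact ⟨p, hs.mem_toFinset.2 hp, hx⟩)
  replace hfin : p.toAddSubgroup.FiniteIndex := hfin
  have hfin' : Finite (N ⧸ p) := AddSubgroup.finite_quotient_of_finiteIndex
  have hne : p ≠ ⊤ := ne_of_mem_of_not_mem (hs.mem_toFinset.1 hp) htop
  have : Nontrivial (N ⧸ p) := Submodule.Quotient.nontrivial_iff.mpr hne
  -- `R ⧸ ann q` embeds into the finite module `N ⧸ p` and surjects onto the residue field.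
  obtain ⟨q, hq⟩ := exists_ne (0 : N ⧸ p)
  have hker : LinearMap.ker (LinearMap.toSpanSingleton R (N ⧸ p) q) ≤ maximalIdeal R := by
    refine le_maximalIdeal fun h => hq ?_
    have : (1 : R) ∈ LinearMap.ker (LinearMap.toSpanSingleton R (N ⧸ p) q) := by
      rw [h]; trivial
    simpa using this
  have h1 : Finite (R ⧸ LinearMap.ker (LinearMap.toSpanSingleton R (N ⧸ p) q)) :=
    Finite.of_injective _ (LinearMap.ker_eq_bot.1
      (Submodule.ker_liftQ_eq_bot _ _ le_rfl le_rfl :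
        LinearMap.ker (Submodule.liftQ _ (LinearMap.toSpanSingleton R (N ⧸ p) q) le_rfl) = ⊥))
  have h2 : Finite (ResidueField R) :=
    Finite.of_surjective _ (Ideal.Quotient.factor_surjective hker)
  exact not_finite (ResidueField R)

theorem exists_mem_ideal_forall_notMem [IsLocalRing R] [Infinite (ResidueField R)]
    (I : Ideal R) {s : Set (Ideal R)} (hs : s.Finite) (h : ∀ p ∈ s, ¬ I ≤ p) :
    ∃ x ∈ I, ∀ p ∈ s, x ∉ p := by
  obtain ⟨x, hx⟩ := exists_forall_notMem_of_infinite_residueField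
    (s := (Submodule.comap I.subtype) '' s) (hs.image _) (by
      rintro ⟨p, hp, hpt⟩
      exact h p hp (Submodule.comap_subtype_eq_top.1 hpt))
  exact ⟨x, x.2, fun p hp hxp => hx _ ⟨p, hp, rfl⟩ hxp⟩

/-- `x` is a nonzerodivisor on `R ⧸ J`. -/
def RegularModulo (J : Ideal R) (x : R) : Prop :=
  ∀ y, x * y ∈ J → y ∈ J

/-- The primes in question are the associated primes of `R ⧸ J`, described without passing to the
quotient. -/
theorem exists_finite_primes_regularModulo [IsNoetherianRing R] (J : Ideal R) :
    ∃ s : Set (Ideal R), s.Finite ∧ (∀ p ∈ s, p.IsPrime ∧ ∃ y ∉ J, ∀ c ∈ p, c * y ∈ J) ∧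
      ∀ x, (∀ p ∈ s, x ∉ p) → RegularModulo J x := by
  refine ⟨associatedPrimes R (R ⧸ J), associatedPrimes.finite R (R ⧸ J), ?_, ?_⟩
  · intro p hp
    have hp' : IsAssociatedPrime p (R ⧸ J) := hp
    obtain ⟨hprime, y, hy⟩ := isAssociatedPrime_iff.1 hp'
    obtain ⟨y, rfl⟩ := Ideal.Quotient.mk_surjective y
    have key : ∀ c, c ∈ p ↔ c * y ∈ J := by
      intro c
      rw [hy, Submodule.mem_colon_singleton, Submodule.mem_bot, ← Ideal.Quotient.eq_zero_iff_mem,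
        map_mul]
      rfl
    refine ⟨hprime, y, fun hyJ => hprime.ne_top ?_, fun c hc => (key c).1 hc⟩
    exact (Ideal.eq_top_iff_one _).2 ((key 1).2 (by simpa using hyJ))
  · intro x hx y hxy
    have hreg : x ∈ { r : R | IsSMulRegular (R ⧸ J) r } := by
      by_contra hcon
      have : x ∈ ⋃ p ∈ associatedPrimes R (R ⧸ J), (p : Set R) := by
        rw [biUnion_associatedPrimes_eq_compl_regular]; exact hcon
      simp only [Set.mem_iUnion] at this
      obtain ⟨p, hp, hxp⟩ := this
      exact hx p hp hxp
    have h0 : x • (Ideal.Quotient.mk J y) = x • (0 : R ⧸ J) := by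
      rw [smul_zero]
      exact Ideal.Quotient.eq_zero_iff_mem.2 hxy
    exact Ideal.Quotient.eq_zero_iff_mem.1 (hreg h0)

/-- The exchange of the two terms of a regular sequence `y, z` on `R ⧸ J`, as far as it concerns
`y`. No Nakayama argument is involved. -/
theorem RegularModulo.of_swap {J : Ideal R} {y z : R} (hy : RegularModulo J y)
    (hzy : RegularModulo (J ⊔ Ideal.span {y}) z) :
    RegularModulo (J ⊔ Ideal.span {z}) y := by
  intro a ha
  obtain ⟨b, j, hj, e⟩ := Ideal.mem_span_singleton_sup.1 (sup_comm J _ ▸ ha)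
  have h1 : b ∈ J ⊔ Ideal.span {y} := by
    apply hzy
    rw [sup_comm, Ideal.mem_span_singleton_sup]
    exact ⟨a, -j, neg_mem hj, by linear_combination -e⟩
  obtain ⟨b', j', hj', rfl⟩ := Ideal.mem_span_singleton_sup.1 (sup_comm J _ ▸ h1)
  have h2 : a - z * b' ∈ J := by
    apply hy
    have : y * (a - z * b') = j' * z + j := by linear_combination -e
    rw [this]
    exact add_mem (J.mul_mem_right _ hj') hj
  rw [sup_comm, Ideal.mem_span_singleton_sup]
  exact ⟨b', _, h2, by ring⟩

end Avoidance

/-! ### Depth of residue rings -/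

section Depth

variable {R : Type*} [CommRing R] [IsLocalRing R]

/-- The socle of `R ⧸ J` vanishes, that is, the maximal ideal is not an associated prime of `J`. -/
def SocleFree (J : Ideal R) : Prop :=
  ∀ y, (∀ c ∈ maximalIdeal R, c * y ∈ J) → y ∈ J

/-- `R ⧸ J` has depth at least `n`, witnessed by a regular sequence of length `n` in the maximal
ideal. -/
def DepthAtLeast : ℕ → Ideal R → Prop
  | 0, _ => True
  | n + 1, J => ∃ x ∈ maximalIdeal R, RegularModulo J x ∧ DepthAtLeast n (J ⊔ Ideal.span {x})

theorem RegularModulo.socleFree {J : Ideal R} {x : R} (hx : RegularModulo J x)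
    (hxm : x ∈ maximalIdeal R) : SocleFree J :=
  fun y hy => hx y (hy x hxm)

theorem DepthAtLeast.socleFree {n : ℕ} {J : Ideal R} (h : DepthAtLeast (n + 1) J) :
    SocleFree J := by
  obtain ⟨x, hxm, hx, -⟩ := h
  exact hx.socleFree hxm

/-- Whether the socle of `R ⧸ (J, x)` vanishes does not depend on the regular element `x`: if
`y a = x b` modulo `J`, then `a ↦ b` embeds the socle of `R ⧸ (J, x)` into that of `R ⧸ (J, y)`. -/
theorem SocleFree.sup_span_singleton {J : Ideal R} {x y : R} (hym : y ∈ maximalIdeal R)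
    (hx : RegularModulo J x) (hy : RegularModulo J y) (h : SocleFree (J ⊔ Ideal.span {y})) :
    SocleFree (J ⊔ Ideal.span {x}) := by
  intro a ha
  obtain ⟨b, j, hj, e⟩ := Ideal.mem_span_singleton_sup.1 (sup_comm J _ ▸ ha y hym)
  have hb : b ∈ J ⊔ Ideal.span {y} := by
    refine h b fun c hc => ?_
    obtain ⟨a', j', hj', e'⟩ := Ideal.mem_span_singleton_sup.1 (sup_comm J _ ▸ ha c hc)
    have h1 : c * b - y * a' ∈ J := by
      apply hx
      have : x * (c * b - y * a') = y * j' - c * j := by linear_combination c * e - y * e'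
      rw [this]
      exact sub_mem (J.mul_mem_left _ hj') (J.mul_mem_left _ hj)
    rw [sup_comm, Ideal.mem_span_singleton_sup]
    exact ⟨a', _, h1, by ring⟩
  obtain ⟨b', j', hj', rfl⟩ := Ideal.mem_span_singleton_sup.1 (sup_comm J _ ▸ hb)
  have h2 : a - x * b' ∈ J := by
    apply hy
    have : y * (a - x * b') = j' * x + j := by linear_combination -e
    rw [this]
    exact add_mem (J.mul_mem_right _ hj') hj
  rw [sup_comm, Ideal.mem_span_singleton_sup]
  exact ⟨b', _, h2, by ring⟩

theorem SocleFree.exists_finite_primes [IsNoetherianRing R] {J : Ideal R} (h : SocleFree J) :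
    ∃ s : Set (Ideal R), s.Finite ∧ (∀ p ∈ s, p.IsPrime ∧ ¬ maximalIdeal R ≤ p) ∧
      ∀ x, (∀ p ∈ s, x ∉ p) → RegularModulo J x := by
  obtain ⟨s, hs, hp, hreg⟩ := exists_finite_primes_regularModulo J
  refine ⟨s, hs, fun p hps => ⟨(hp p hps).1, fun hle => ?_⟩, hreg⟩
  obtain ⟨y, hy, hc⟩ := (hp p hps).2
  exact hy (h y fun c hcm => hc c (hle hcm))

/-- Dividing by an arbitrary regular element lowers the depth by at most one. If `y` starts the
given regular sequence, the proof passes from `y` to `x` through an element `z` that is regular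
modulo `J`, `(J, y)` and `(J, x)`. -/
theorem DepthAtLeast.sup_span_singleton [IsNoetherianRing R] [Infinite (ResidueField R)] {n : ℕ}
    {J : Ideal R} {x : R} (h : DepthAtLeast (n + 1) J) (hxm : x ∈ maximalIdeal R)
    (hx : RegularModulo J x) : DepthAtLeast n (J ⊔ Ideal.span {x}) := by
  induction n generalizing J x with
  | zero => trivial
  | succ k ih =>
    obtain ⟨y, hym, hy, hD⟩ := h
    obtain ⟨s₁, hs₁, hp₁, hr₁⟩ := (hx.socleFree hxm).exists_finite_primes
    obtain ⟨s₂, hs₂, hp₂, hr₂⟩ := hD.socleFree.exists_finite_primes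
    obtain ⟨s₃, hs₃, hp₃, hr₃⟩ := (hD.socleFree.sup_span_singleton hym hx hy).exists_finite_primes
    obtain ⟨z, hzm, hz⟩ := exists_mem_ideal_forall_notMem (maximalIdeal R)
      ((hs₁.union hs₂).union hs₃) (by
        rintro p ((hp | hp) | hp)
        exacts [(hp₁ p hp).2, (hp₂ p hp).2, (hp₃ p hp).2])
    have hzJ := hr₁ z fun p hp => hz p (Or.inl (Or.inl hp))
    have hzy := hr₂ z fun p hp => hz p (Or.inl (Or.inr hp))
    have hzx := hr₃ z fun p hp => hz p (Or.inr hp)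
    have h1 : DepthAtLeast (k + 1) (J ⊔ Ideal.span {z}) :=
      ⟨y, hym, hy.of_swap hzy, by rw [sup_right_comm]; exact ih hD hzm hzy⟩
    refine ⟨z, hzm, hzx, ?_⟩
    rw [sup_right_comm]
    exact ih h1 hxm (hx.of_swap hzx)

open Pointwise in
theorem depthAtLeast_of_isWeaklyRegular {rs : List R} (hm : ∀ r ∈ rs, r ∈ maximalIdeal R)
    {J : Ideal R} (h : RingTheory.Sequence.IsWeaklyRegular (R ⧸ J) rs) :
    DepthAtLeast rs.length J := by
  induction rs generalizing J with
  | nil => trivial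
  | cons r rs ih =>
    -- The tail is regular on `(R ⧸ J) ⧸ r (R ⧸ J)`, which is identified with `R ⧸ (J, r)`.
    rw [RingTheory.Sequence.isWeaklyRegular_cons_iff] at h
    refine ⟨r, hm r (by simp), fun y hy => ?_, ih (fun a ha => hm a (by simp [ha])) ?_⟩
    · have h0 : r • (Ideal.Quotient.mk J y) = r • (0 : R ⧸ J) := by
        rw [smul_zero]
        exact Ideal.Quotient.eq_zero_iff_mem.2 hy
      exact Ideal.Quotient.eq_zero_iff_mem.1 (h.1 h0)
    · have hmap : r • (⊤ : Submodule R (R ⧸ J)) = Submodule.map J.mkQ (J ⊔ Ideal.span {r}) := by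
        rw [Submodule.map_sup, Submodule.mkQ_map_self, bot_sup_eq, Ideal.span,
          Submodule.map_span, Set.image_singleton]
        ext t
        rw [Submodule.mem_smul_pointwise_iff_exists, Submodule.mem_span_singleton]
        constructor
        · rintro ⟨b, -, rfl⟩
          obtain ⟨b, rfl⟩ := Submodule.mkQ_surjective _ b
          exact ⟨b, by rw [← map_smul, ← map_smul, smul_eq_mul, smul_eq_mul, mul_comm]⟩
        · rintro ⟨b, rfl⟩
          exact ⟨J.mkQ b, trivial, by
            rw [← map_smul, ← map_smul, smul_eq_mul, smul_eq_mul, mul_comm]⟩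
      exact (((Submodule.quotEquivOfEq _ _ hmap).trans
        (Submodule.quotientQuotientEquivQuotient J _ le_sup_left)).isWeaklyRegular_congr rs).1 h.2

theorem DepthAtLeast.mono {m n : ℕ} (hmn : m ≤ n) {J : Ideal R} (h : DepthAtLeast n J) :
    DepthAtLeast m J := by
  induction n generalizing m J with
  | zero => rwa [Nat.le_zero.1 hmn]
  | succ n ih =>
    cases m with
    | zero => trivial
    | succ m =>
      obtain ⟨x, hxm, hx, hD⟩ := h
      exact ⟨x, hxm, hx, ih (Nat.le_of_succ_le_succ hmn) hD⟩

theorem depthAtLeast_of_le_depth {d : ℕ} (h : (d : ℕ∞) ≤ depth R) :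
    DepthAtLeast d (⊥ : Ideal R) := by
  cases d with
  | zero => trivial
  | succ k =>
    obtain ⟨⟨rs, hreg, hm⟩, hlt⟩ := lt_iSup_iff.1
      (lt_of_lt_of_le (Nat.cast_lt.2 (Nat.lt_succ_self k)) h)
    have hbot : RingTheory.Sequence.IsWeaklyRegular (R ⧸ (⊥ : Ideal R)) rs :=
      ((Submodule.quotEquivOfEqBot (⊥ : Ideal R) rfl).isWeaklyRegular_congr rs).2
        hreg.toIsWeaklyRegular
    exact (depthAtLeast_of_isWeaklyRegular hm hbot).mono (Nat.cast_lt.1 hlt)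

end Depth

/-! ### Superficial sequences and minimal reductions -/

section Superficial

/-- An element `z` outside finitely many primes not containing `Q` satisfies `(𝔟 : z) ⊆ (𝔟 : Q ^ c)`
for a fixed `c`: the primes are those associated to the saturation of `𝔟` with respect to `Q`, on
whose residue ring `z` is then regular. -/
theorem exists_finite_primes_colon_le {A : Type*} [CommRing A] [IsNoetherianRing A]
    (𝔟 Q : Ideal A) :
    ∃ s : Set (Ideal A), s.Finite ∧ (∀ p ∈ s, p.IsPrime ∧ ¬ Q ≤ p) ∧
      ∃ c : ℕ, ∀ z, (∀ p ∈ s, z ∉ p) → ∀ g, z * g ∈ 𝔟 → ∀ q ∈ Q ^ c, q * g ∈ 𝔟 := by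
  let f : ℕ →o Ideal A := ⟨fun c => 𝔟.colon ((Q ^ c : Ideal A) : Set A), fun a b hab =>
    Submodule.colon_mono le_rfl (Ideal.pow_le_pow_right hab)⟩
  have hf : ∀ c g, g ∈ f c ↔ ∀ q ∈ Q ^ c, q * g ∈ 𝔟 := by
    intro c g
    change g ∈ 𝔟.colon ((Q ^ c : Ideal A) : Set A) ↔ _
    simp only [Submodule.mem_colon, SetLike.mem_coe, smul_eq_mul, mul_comm g]
  obtain ⟨c, hc⟩ := monotone_stabilizes_iff_noetherian.2 ‹IsNoetherianRing A› f
  obtain ⟨s, hs, hp, hreg⟩ := exists_finite_primes_regularModulo (f c)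
  refine ⟨s, hs, fun p hps => ⟨(hp p hps).1, fun hle => ?_⟩, c, fun z hz g hzg => ?_⟩
  · obtain ⟨y, hy, hpy⟩ := (hp p hps).2
    apply hy
    rw [hc (c + 1) (Nat.le_succ c), hf]
    intro q hq
    rw [pow_succ] at hq
    induction hq using Submodule.mul_induction_on' with
    | mem_mul_mem a ha b hb =>
      rw [mul_assoc]
      exact (hf c _).1 (hpy b (hle hb)) a ha
    | add a _ b _ ha hb => rw [add_mul]; exact add_mem ha hb
  · rw [← hf]
    refine hreg z hz g ((hf _ _).2 fun q _ => ?_)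
    exact 𝔟.mul_mem_left _ hzg

variable {R : Type*} [CommRing R]

/-- Inside the Rees algebra of `𝔞`, the ideal of those polynomials whose `n`-th coefficient lies
in `J + 𝔞 ^ (n + 1)` for every `n`. The quotient by it is the associated graded ring of the
`𝔞`-adic filtration on `R ⧸ J`. -/
def initialIdeal (𝔞 J : Ideal R) : Ideal (reesAlgebra 𝔞) where
  carrier := {f | ∀ n, (f : Polynomial R).coeff n ∈ J ⊔ 𝔞 ^ (n + 1)}
  add_mem' ha hb n := by
    simpa only [Subalgebra.coe_add, Polynomial.coeff_add] using add_mem (ha n) (hb n)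
  zero_mem' n := by simp
  smul_mem' g f hf n := by
    simp only [smul_eq_mul, Subalgebra.coe_mul, Polynomial.coeff_mul]
    refine sum_mem fun ij hij => ?_
    obtain ⟨i, j⟩ := ij
    obtain rfl : i + j = n := Finset.HasAntidiagonal.mem_antidiagonal.1 hij
    have h1 : (g : Polynomial R).coeff i * (f : Polynomial R).coeff j ∈
        𝔞 ^ i * (J ⊔ 𝔞 ^ (j + 1)) := Ideal.mul_mem_mul (g.2 i) (hf j)
    rw [Ideal.mul_sup, ← pow_add, ← add_assoc] at h1
    exact (sup_le_sup_right Ideal.mul_le_right (𝔞 ^ (i + j + 1)) :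
      𝔞 ^ i * J ⊔ 𝔞 ^ (i + j + 1) ≤ J ⊔ 𝔞 ^ (i + j + 1)) h1

/-- The element `r` of `𝔞 ^ n` as a homogeneous element of degree `n` of the Rees algebra. -/
noncomputable def reesMonomial (𝔞 : Ideal R) (n : ℕ) : ↥(𝔞 ^ n) →ₗ[R] reesAlgebra 𝔞 where
  toFun r := ⟨Polynomial.monomial n (r : R), reesAlgebra.monomial_mem.2 r.2⟩
  map_add' a b := Subtype.ext (by simp)
  map_smul' a b := Subtype.ext (by simp [Polynomial.smul_monomial])

theorem coe_reesMonomial (𝔞 : Ideal R) (n : ℕ) (r : ↥(𝔞 ^ n)) :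
    (reesMonomial 𝔞 n r : Polynomial R) = Polynomial.monomial n (r : R) := rfl

theorem reesMonomial_mul (𝔞 : Ideal R) (m n : ℕ) {a b : R} (ha : a ∈ 𝔞 ^ m) (hb : b ∈ 𝔞 ^ n)
    (hab : a * b ∈ 𝔞 ^ (m + n)) :
    reesMonomial 𝔞 (m + n) ⟨a * b, hab⟩ = reesMonomial 𝔞 m ⟨a, ha⟩ * reesMonomial 𝔞 n ⟨b, hb⟩ :=
  Subtype.ext (by simp [coe_reesMonomial, Polynomial.monomial_mul_monomial])

/-- The Rees algebra is generated in degree one: its elements of degree `k ≥ c` lie in the `c`-th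
power of the ideal generated by the elements of degree one. -/
theorem reesMonomial_mem_pow (𝔞 : Ideal R) {c k : ℕ} (hck : c ≤ k) (r : ↥(𝔞 ^ k)) :
    reesMonomial 𝔞 k r ∈ Ideal.span (Set.range (reesMonomial 𝔞 1)) ^ c := by
  induction c generalizing k with
  | zero => simp
  | succ c ih =>
    obtain ⟨k, rfl⟩ := Nat.exists_eq_add_of_le' (Nat.one_le_of_lt hck)
    obtain ⟨r, hr⟩ := r
    have hr' := hr
    rw [pow_succ] at hr'
    have key : ∃ h : r ∈ 𝔞 ^ (k + 1), reesMonomial 𝔞 (k + 1) ⟨r, h⟩ ∈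
        Ideal.span (Set.range (reesMonomial 𝔞 1)) ^ (c + 1) := by
      induction hr' using Submodule.mul_induction_on' with
      | mem_mul_mem a ha b hb =>
        refine ⟨by rw [pow_succ]; exact Ideal.mul_mem_mul ha hb, ?_⟩
        have hb1 : b ∈ 𝔞 ^ 1 := by rwa [pow_one]
        rw [reesMonomial_mul 𝔞 k 1 ha hb1, pow_succ]
        exact Ideal.mul_mem_mul (ih (by omega) _) (Ideal.subset_span ⟨_, rfl⟩)
      | add a ha b hb h₁ h₂ =>
        rw [← pow_succ] at ha hb
        obtain ⟨ha, h₁⟩ := h₁ ha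
        obtain ⟨hb, h₂⟩ := h₂ hb
        refine ⟨add_mem ha hb, ?_⟩
        have : reesMonomial 𝔞 (k + 1) ⟨a + b, add_mem ha hb⟩ =
          reesMonomial 𝔞 (k + 1) ⟨a, ha⟩ + reesMonomial 𝔞 (k + 1) ⟨b, hb⟩ := by
          rw [← map_add]; rfl
        rw [this]
        exact add_mem h₁ h₂
    exact key.2

/-- If a power of the irrelevant ideal of the associated graded ring kills the class of `f`, then
every multiple of `f` vanishes there in large degrees, with a bound that does not depend on the
multiplier. -/
theorem coeff_mul_mem_of_pow_mul_mem {𝔞 J : Ideal R} {c : ℕ} {f : reesAlgebra 𝔞}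
    (hf : ∀ q ∈ Ideal.span (Set.range (reesMonomial 𝔞 1)) ^ c, q * f ∈ initialIdeal 𝔞 J)
    (g : reesAlgebra 𝔞) {n : ℕ} (hn : (f : Polynomial R).natDegree + c ≤ n) :
    ((g : Polynomial R) * f).coeff n ∈ J ⊔ 𝔞 ^ (n + 1) := by
  rw [Polynomial.coeff_mul]
  refine sum_mem fun ij hij => ?_
  obtain ⟨i, j⟩ := ij
  obtain rfl : i + j = n := Finset.HasAntidiagonal.mem_antidiagonal.1 hij
  by_cases hj : (f : Polynomial R).natDegree < j
  · simp [Polynomial.coeff_eq_zero_of_natDegree_lt hj]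
  · have h1 := hf _ (reesMonomial_mem_pow 𝔞 (show c ≤ i by omega)
      ⟨(g : Polynomial R).coeff i, g.2 i⟩) (i + j)
    simpa [coe_reesMonomial, add_comm i j, Polynomial.coeff_monomial_mul] using h1

/-- Suppose that `I` is a reduction of `𝔞`. Outside finitely many proper submodules of `I`, the
initial form of `x` is a nonzerodivisor in large degrees on the associated graded ring of `R ⧸ J`.
The submodules consist of the elements whose initial forms lie in a relevant associated prime `P`;
they are proper because `I 𝔞 ^ r = 𝔞 ^ (r + 1)` would otherwise make `P` irrelevant. -/
theorem exists_finite_primes_superficial [IsNoetherianRing R] {𝔞 I : Ideal R} (hI : I ≤ 𝔞)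
    {r : ℕ} (hr : I * 𝔞 ^ r = 𝔞 ^ (r + 1)) (J : Ideal R) :
    ∃ s : Set (Submodule R I), s.Finite ∧ ⊤ ∉ s ∧ ∀ x : I, (∀ p ∈ s, x ∉ p) →
      ∃ N, ∀ n ≥ N, ∀ y ∈ 𝔞 ^ n, (x : R) * y ∈ J ⊔ 𝔞 ^ (n + 2) → y ∈ J ⊔ 𝔞 ^ (n + 1) := by
  obtain ⟨s, hs, hp, c, hc⟩ := exists_finite_primes_colon_le (initialIdeal 𝔞 J)
    (Ideal.span (Set.range (reesMonomial 𝔞 1)))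
  have hI1 : I ≤ 𝔞 ^ 1 := by rwa [pow_one]
  let φ : I →ₗ[R] reesAlgebra 𝔞 := reesMonomial 𝔞 1 ∘ₗ Submodule.inclusion hI1
  refine ⟨(fun P : Ideal (reesAlgebra 𝔞) => (P.restrictScalars R).comap φ) '' s, hs.image _, ?_, ?_⟩
  · rintro ⟨P, hP, htop⟩
    refine (hp P hP).2 (Ideal.span_le.2 ?_)
    have hprime := (hp P hP).1
    have hφ : ∀ x (hx : x ∈ I), reesMonomial 𝔞 1 ⟨x, hI1 hx⟩ ∈ P := fun x hx => by
      have : (⟨x, hx⟩ : I) ∈ (P.restrictScalars R).comap φ := by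
        have : (P.restrictScalars R).comap φ = ⊤ := htop
        rw [this]; trivial
      exact this
    have key : ∀ u ∈ I * 𝔞 ^ r, ∃ h : u ∈ 𝔞 ^ (1 + r), reesMonomial 𝔞 (1 + r) ⟨u, h⟩ ∈ P := by
      intro u hu
      induction hu using Submodule.mul_induction_on' with
      | mem_mul_mem a ha b hb =>
        refine ⟨by rw [pow_add]; exact Ideal.mul_mem_mul (hI1 ha) hb, ?_⟩
        rw [reesMonomial_mul 𝔞 1 r (hI1 ha) hb]
        exact P.mul_mem_right _ (hφ a ha)
      | add a _ b _ h₁ h₂ =>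
        obtain ⟨ha, h₁⟩ := h₁
        obtain ⟨hb, h₂⟩ := h₂
        refine ⟨add_mem ha hb, ?_⟩
        have : reesMonomial 𝔞 (1 + r) ⟨a + b, add_mem ha hb⟩ =
          reesMonomial 𝔞 (1 + r) ⟨a, ha⟩ + reesMonomial 𝔞 (1 + r) ⟨b, hb⟩ := by
          rw [← map_add]; rfl
        rw [this]
        exact add_mem h₁ h₂
    rintro _ ⟨⟨a, ha⟩, rfl⟩
    rw [SetLike.mem_coe]
    refine hprime.mem_of_pow_mem (1 + r) ?_
    obtain ⟨h, hmem⟩ := key (a ^ (1 + r)) (by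
      rw [hr, add_comm 1 r]; rw [pow_one] at ha; exact Ideal.pow_mem_pow ha _)
    convert hmem
    exact Subtype.ext (by simp [coe_reesMonomial, Polynomial.monomial_pow])
  · intro x hx
    have hz := hc (φ x) fun P hP hmem => hx _ ⟨P, hP, rfl⟩ hmem
    -- `K` is finitely generated, so the degrees of its generators are bounded.
    let K : Ideal (reesAlgebra 𝔞) := (initialIdeal 𝔞 J).colon {φ x}
    have hK : ∀ g, g ∈ K ↔ φ x * g ∈ initialIdeal 𝔞 J := fun g => by
      rw [Submodule.mem_colon_singleton, smul_eq_mul, mul_comm]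
    obtain ⟨S, hS⟩ := (IsNoetherian.noetherian K : K.FG)
    refine ⟨S.sup (fun f => (f : Polynomial R).natDegree) + c, fun n hn y hy hxy => ?_⟩
    have hyK : reesMonomial 𝔞 n ⟨y, hy⟩ ∈ K := by
      rw [hK]
      intro k
      have : ((φ x * reesMonomial 𝔞 n ⟨y, hy⟩ : reesAlgebra 𝔞) : Polynomial R) =
          Polynomial.monomial (1 + n) ((x : R) * y) := by
        simp [φ, coe_reesMonomial, Polynomial.monomial_mul_monomial]
      rw [this, Polynomial.coeff_monomial]
      split_ifs with h
      · subst h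
        rwa [show 1 + n + 1 = n + 2 by omega]
      · exact zero_mem _
    rw [← hS] at hyK
    obtain ⟨g, -, hg⟩ := Submodule.mem_span_finset.1 hyK
    have h1 := congrArg (fun f : reesAlgebra 𝔞 => (f : Polynomial R).coeff n) hg
    simp only [coe_reesMonomial, Polynomial.coeff_monomial, if_true] at h1
    rw [← h1, AddSubmonoidClass.coe_finsetSum, Polynomial.finsetSum_coeff]
    refine sum_mem fun f hfS => ?_
    have hfK : f ∈ K := hS ▸ Ideal.subset_span hfS
    exact coeff_mul_mem_of_pow_mul_mem (hz f ((hK f).1 hfK)) (g f) (le_trans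
      (Nat.add_le_add_right (Finset.le_sup
        (f := fun f : reesAlgebra 𝔞 => (f : Polynomial R).natDegree) hfS) c) hn)

/-- The Artin–Rees lemma for the principal submodule `x (R ⧸ J)`. -/
theorem exists_forall_mem_sup_pow_of_mul_mem [IsNoetherianRing R] (𝔞 : Ideal R) {J : Ideal R}
    {x : R} (hx : RegularModulo J x) :
    ∃ c, ∀ n ≥ c, ∀ y, x * y ∈ J ⊔ 𝔞 ^ n → y ∈ J ⊔ 𝔞 ^ (n - c) := by
  obtain ⟨c, hc⟩ := Ideal.exists_pow_inf_eq_pow_smul 𝔞 (Submodule.span R {J.mkQ x})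
  refine ⟨c, fun n hn y hxy => ?_⟩
  have hmem : J.mkQ (x * y) ∈ 𝔞 ^ (n - c) • Submodule.span R {J.mkQ x} := by
    refine (smul_mono_right _ (inf_le_right (a := 𝔞 ^ c • ⊤)) :
      𝔞 ^ (n - c) • (𝔞 ^ c • ⊤ ⊓ Submodule.span R {J.mkQ x}) ≤ _) ?_
    rw [← hc n hn]
    constructor
    · obtain ⟨j, hj, z, hz, e⟩ := Submodule.mem_sup.1 hxy
      rw [← e, map_add, (Submodule.Quotient.mk_eq_zero J).2 hj |> fun h => (h : J.mkQ j = 0),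
        zero_add]
      have : J.mkQ z = z • J.mkQ 1 := by rw [← map_smul, smul_eq_mul, mul_one]
      rw [this]
      exact Submodule.smul_mem_smul hz trivial
    · rw [mul_comm, ← smul_eq_mul, map_smul]
      exact Submodule.smul_mem _ _ (Submodule.mem_span_singleton_self _)
  obtain ⟨z, hz, e⟩ := Submodule.mem_smul_span_singleton.1 hmem
  rw [← map_smul, ← sub_eq_zero, ← map_sub] at e
  have h1 : z • x - x * y ∈ J := (Submodule.Quotient.mk_eq_zero J).1 e
  have h2 : z - y ∈ J := hx _ (by convert h1 using 1; rw [smul_eq_mul]; ring)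
  have : y = -(z - y) + z := by ring
  rw [this]
  exact Submodule.add_mem_sup (neg_mem h2) hz

variable [IsLocalRing R]

/-- `x` is superficial modulo `J` for the `𝔪`-adic filtration: multiplication by `x` on
`R ⧸ J` is eventually strict. -/
def IsSuperficialModulo (J : Ideal R) (x : R) : Prop :=
  ∃ N, ∀ n ≥ N, ∀ y, x * y ∈ J ⊔ maximalIdeal R ^ (n + 1) → y ∈ J ⊔ maximalIdeal R ^ n

theorem exists_superficial_regularModulo [IsNoetherianRing R] [Infinite (ResidueField R)]
    {I : Ideal R} (hI : IsReduction I (maximalIdeal R)) {J : Ideal R} (hJ : SocleFree J) :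
    ∃ x ∈ I, RegularModulo J x ∧ IsSuperficialModulo J x := by
  obtain ⟨hIm, r, hr⟩ := hI
  obtain ⟨s, hs, htop, hsup⟩ := exists_finite_primes_superficial hIm hr J
  obtain ⟨t, ht, hpt, hreg⟩ := hJ.exists_finite_primes
  obtain ⟨x, hx⟩ := exists_forall_notMem_of_infinite_residueField
    (hs.union (ht.image (Submodule.comap I.subtype))) (by
      rintro (h | ⟨p, hp, h⟩)
      · exact htop h
      · have hIp : I ≤ p := Submodule.comap_subtype_eq_top.1 h
        have := (hpt p hp).1
        refine (hpt p hp).2 (Ideal.IsPrime.le_of_pow_le (n := r + 1) ?_)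
        rw [← hr]
        exact Ideal.mul_le_left.trans hIp)
  have hxreg : RegularModulo J (x : R) := hreg x fun p hp hxp => hx _ (Or.inr ⟨p, hp, rfl⟩) hxp
  refine ⟨x, x.2, hxreg, ?_⟩
  obtain ⟨N, hN⟩ := hsup x fun p hp => hx p (Or.inl hp)
  obtain ⟨c, hc⟩ := exists_forall_mem_sup_pow_of_mul_mem (maximalIdeal R) hxreg
  refine ⟨N + c, fun n hn y hxy => ?_⟩
  -- Artin–Rees places `y` in `J + 𝔪 ^ (n + 1 - c)`, and regularity of the initial form of `x`
  -- raises the exponent one step at a time.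
  have climb : ∀ j, N ≤ j → y ∈ J ⊔ maximalIdeal R ^ j → j + 1 ≤ n →
      y ∈ J ⊔ maximalIdeal R ^ (j + 1) := by
    intro j hj hy hjn
    obtain ⟨u, hu, v, hv, rfl⟩ := Submodule.mem_sup.1 hy
    refine add_mem (Ideal.mem_sup_left hu) (hN j hj v hv ?_)
    have : (x : R) * v = -(x * u) + x * (u + v) := by ring
    rw [this]
    exact add_mem (Ideal.mem_sup_left (neg_mem (J.mul_mem_left _ hu)))
      (sup_le_sup_left (Ideal.pow_le_pow_right (by omega)) J hxy)
  have hind : ∀ k, k ≤ c → y ∈ J ⊔ maximalIdeal R ^ (n - c + k) := by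
    intro k
    induction k with
    | zero =>
      intro _
      exact sup_le_sup_left (Ideal.pow_le_pow_right (by omega)) J (hc (n + 1) (by omega) y hxy)
    | succ k ih => exact fun hk => climb (n - c + k) (by omega) (ih (by omega)) (by omega)
  have := hind c le_rfl
  rwa [Nat.sub_add_cancel (by omega)] at this

/-- `J` is generated by a regular sequence `x₁, …, xₙ` of elements of `I` each of which is
superficial modulo the preceding ones. -/
inductive SuperficialSequence (I : Ideal R) : ℕ → Ideal R → Prop
  | zero : SuperficialSequence I 0 ⊥
  | succ {n : ℕ} {J : Ideal R} {x : R} (hJ : SuperficialSequence I n J) (hxI : x ∈ I)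
      (hreg : RegularModulo J x) (hsup : IsSuperficialModulo J x) :
      SuperficialSequence I (n + 1) (J ⊔ Ideal.span {x})

/-- Superficial regular elements can be chosen one after the other: by the exchange property of
depth, `R ⧸ J` keeps positive depth as long as fewer than `d` elements have been chosen. -/
theorem exists_superficialSequence [IsNoetherianRing R] [Infinite (ResidueField R)]
    {I : Ideal R} (hI : IsReduction I (maximalIdeal R)) {d : ℕ}
    (hd : DepthAtLeast d (⊥ : Ideal R)) : ∃ J, SuperficialSequence I d J := by
  have key : ∀ n, n ≤ d → ∃ J, SuperficialSequence I n J ∧ DepthAtLeast (d - n) J := by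
    intro n
    induction n with
    | zero => exact fun _ => ⟨⊥, .zero, hd⟩
    | succ n ih =>
      intro hn
      obtain ⟨J, hJ, hD⟩ := ih (by omega)
      rw [show d - n = d - (n + 1) + 1 by omega] at hD
      obtain ⟨x, hxI, hreg, hsup⟩ := exists_superficial_regularModulo hI hD.socleFree
      exact ⟨_, hJ.succ hxI hreg hsup, hD.sup_span_singleton (hI.1 hxI) hreg⟩
  obtain ⟨J, hJ, -⟩ := key d le_rfl
  exact ⟨J, hJ⟩

theorem SuperficialSequence.le {I J : Ideal R} {n : ℕ} (h : SuperficialSequence I n J) :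
    J ≤ I := by
  induction h with
  | zero => exact bot_le
  | succ _ hxI _ _ ih => exact sup_le ih ((Ideal.span_singleton_le_iff_mem _).2 hxI)

/-- Each term of a regular sequence avoids the minimal primes of the preceding ones, so that the
height grows with every term. -/
theorem SuperficialSequence.le_height [IsNoetherianRing R] {I J : Ideal R} {n : ℕ}
    (h : SuperficialSequence I n J) {p : Ideal R} [hp : p.IsPrime] (hJp : J ≤ p) :
    (n : ℕ∞) ≤ p.height := by
  induction h generalizing p with
  | zero => simp
  | @succ n J x hJ hxI hreg hsup ih =>
    obtain ⟨q, hq, hqp⟩ := Ideal.exists_minimalPrimes_le (le_sup_left.trans hJp)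
    have hqprime : q.IsPrime := hq.1.1
    have hxq : x ∉ q := by
      intro hxq
      have hass : q ∈ associatedPrimes R (R ⧸ J) := by
        apply Module.associatedPrimes.minimalPrimes_annihilator_subset_associatedPrimes
        rwa [Ideal.annihilator_quotient]
      have : x ∈ ⋃ p ∈ associatedPrimes R (R ⧸ J), (p : Set R) := by
        simp only [Set.mem_iUnion]
        exact ⟨q, hass, hxq⟩
      rw [biUnion_associatedPrimes_eq_compl_regular] at this
      refine this fun a b hab => ?_
      obtain ⟨a, rfl⟩ := Ideal.Quotient.mk_surjective a
      obtain ⟨b, rfl⟩ := Ideal.Quotient.mk_surjective b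
      rw [Ideal.Quotient.eq]
      refine hreg _ ?_
      rw [mul_sub]
      exact Ideal.Quotient.eq.1 hab
    have hlt : q < p := lt_of_le_of_ne hqp fun h => hxq (h ▸ hJp
      (Ideal.mem_sup_right (Ideal.mem_span_singleton_self x)))
    have h1 := Ideal.height_add_one_le_of_lt_of_isPrime hlt
    push_cast
    exact (add_le_add_left (ih hq.1.2) 1).trans h1

theorem SuperficialSequence.exists_pow_le [IsNoetherianRing R] {I J : Ideal R} {d : ℕ}
    (h : SuperficialSequence I d J) (hd : ringKrullDim R = d) :
    ∃ N, maximalIdeal R ^ N ≤ J := by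
  refine Ideal.exists_pow_le_of_le_radical_of_fg ?_ (IsNoetherian.noetherian _)
  rw [Ideal.radical_eq_sInf]
  refine le_sInf fun p ⟨hJp, hp⟩ => ?_
  have hht : (p.height : WithBot ℕ∞) = ringKrullDim R :=
    le_antisymm Ideal.height_le_ringKrullDim_of_isPrime
      (hd ▸ WithBot.coe_le_coe.2 (h.le_height hJp))
  exact (Ideal.height_eq_ringKrullDim_iff.1 hht).ge

theorem SuperficialSequence.exists_inf_pow_le {I J : Ideal R} (hI : I ≤ maximalIdeal R) {d : ℕ}
    (h : SuperficialSequence I d J) :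
    ∃ N, ∀ n ≥ N, J ⊓ maximalIdeal R ^ (n + 1) ≤ J * maximalIdeal R ^ n := by
  induction h with
  | zero => exact ⟨0, fun n _ => by simp⟩
  | @succ n J x hJ hxI hreg hsup ih =>
    obtain ⟨N₁, h₁⟩ := ih
    obtain ⟨N₂, h₂⟩ := hsup
    refine ⟨max N₁ N₂, fun n hn u ⟨hu, hum⟩ => ?_⟩
    obtain ⟨y, v, hv, rfl⟩ := Ideal.mem_span_singleton_sup.1 (sup_comm J _ ▸ hu)
    have hy : y ∈ J ⊔ maximalIdeal R ^ n := by
      refine h₂ n (le_of_max_le_right hn) y ?_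
      have : x * y = -v + (y * x + v) := by ring
      rw [this]
      exact Submodule.add_mem_sup (neg_mem hv) hum
    obtain ⟨j, hj, z, hz, rfl⟩ := Submodule.mem_sup.1 hy
    have hxz : x * z ∈ Ideal.span {x} * maximalIdeal R ^ n :=
      Ideal.mul_mem_mul (Ideal.mem_span_singleton_self x) hz
    have hw : j * x + v ∈ J * maximalIdeal R ^ n := by
      refine h₁ n (le_of_max_le_left hn) ⟨add_mem (J.mul_mem_right _ hj) hv, ?_⟩
      have : j * x + v = ((j + z) * x + v) - x * z := by ring
      rw [this]
      refine sub_mem hum ?_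
      rw [pow_succ']
      exact Ideal.mul_mem_mul (hI hxI) hz
    have : (j + z) * x + v = (j * x + v) + x * z := by ring
    rw [this, Ideal.sup_mul]
    exact Submodule.add_mem_sup hw hxz

/-- A minimal reduction is generated by a superficial regular sequence: the ideal `J` of such a
sequence chosen inside `I` contains `𝔪 ^ (n + 1)` for large `n`, whence
`𝔪 ^ (n + 1) = J ∩ 𝔪 ^ (n + 1) ⊆ J 𝔪 ^ n`, so that `J` is itself a reduction. -/
theorem IsMinimalReduction.superficialSequence [IsNoetherianRing R] [Infinite (ResidueField R)]
    {I : Ideal R} (hI : IsMinimalReduction I (maximalIdeal R)) {d : ℕ}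
    (hd : ringKrullDim R = d) (hD : DepthAtLeast d (⊥ : Ideal R)) :
    SuperficialSequence I d I := by
  obtain ⟨J, hJ⟩ := exists_superficialSequence hI.1 hD
  obtain ⟨N₁, h₁⟩ := hJ.exists_pow_le hd
  obtain ⟨N₂, h₂⟩ := hJ.exists_inf_pow_le hI.1.1
  have hred : IsReduction J (maximalIdeal R) := by
    refine ⟨hJ.le.trans hI.1.1, max N₁ N₂, le_antisymm ?_ ?_⟩
    · rw [pow_succ']
      exact Ideal.mul_mono_left (hJ.le.trans hI.1.1)
    · refine le_trans (le_inf ?_ le_rfl) (h₂ _ (le_max_right _ _))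
      exact (Ideal.pow_le_pow_right (by omega)).trans h₁
  have : I = J := le_antisymm (hI.2 hred hJ.le) hJ.le
  rwa [← this] at hJ

end Superficial

/-! ### Lengths and multiplicity -/

section Length

variable {R : Type*} [CommRing R]

/-- Additivity of length on `0 → R ⧸ (L : x) → R ⧸ L → R ⧸ (L, x) → 0`, where `L' = (L : x)`. -/
theorem length_quotient_eq_add {L L' : Ideal R} {x : R} (h : ∀ y, y ∈ L' ↔ x * y ∈ L) :
    Module.length R (R ⧸ L) =
      Module.length R (R ⧸ L') + Module.length R (R ⧸ (L ⊔ Ideal.span {x})) := by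
  let f : (R ⧸ L') →ₗ[R] (R ⧸ L) := L'.mapQ L (LinearMap.mulLeft R x) fun y hy => (h y).1 hy
  let g : (R ⧸ L) →ₗ[R] (R ⧸ (L ⊔ Ideal.span {x})) := Submodule.factor le_sup_left
  refine Module.length_eq_add_of_exact f g ?_ (Submodule.factor_surjective _) ?_
  · rw [injective_iff_map_eq_zero]
    intro a ha
    obtain ⟨a, rfl⟩ := Submodule.mkQ_surjective _ a
    exact (Submodule.Quotient.mk_eq_zero _).2 ((h a).2 ((Submodule.Quotient.mk_eq_zero _).1 ha))
  · intro a
    obtain ⟨a, rfl⟩ := Submodule.mkQ_surjective _ a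
    constructor
    · intro ha
      have ha' : a ∈ L ⊔ Ideal.span {x} := (Submodule.Quotient.mk_eq_zero _).1 ha
      obtain ⟨y, j, hj, rfl⟩ := Ideal.mem_span_singleton_sup.1 (sup_comm L _ ▸ ha')
      refine ⟨L'.mkQ y, (Submodule.Quotient.eq L).2 ?_⟩
      have : x * y - (y * x + j) = -j := by ring
      exact this ▸ neg_mem hj
    · rintro ⟨y, hy⟩
      obtain ⟨y, rfl⟩ := Submodule.mkQ_surjective _ y
      rw [← hy]
      exact (Submodule.Quotient.mk_eq_zero _).2
        (Ideal.mem_sup_right (Ideal.mul_mem_right _ _ (Ideal.mem_span_singleton_self x)))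

theorem length_quotient_mono {K L : Ideal R} (h : K ≤ L) :
    Module.length R (R ⧸ L) ≤ Module.length R (R ⧸ K) :=
  Module.length_le_of_surjective (Submodule.factor h) (Submodule.factor_surjective h)

theorem eq_of_length_quotient_le {K L : Ideal R} (hKL : K ≤ L)
    (hfin : Module.length R (R ⧸ L) ≠ ⊤)
    (h : Module.length R (R ⧸ K) ≤ Module.length R (R ⧸ L)) : K = L := by
  refine le_antisymm hKL fun x hxL => ?_
  by_contra hxK
  have hmem : ∀ y, y ∈ K.colon {x} ↔ x * y ∈ K := fun y => by
    rw [Submodule.mem_colon_singleton, smul_eq_mul, mul_comm]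
  have h1 := length_quotient_eq_add hmem
  have h2 : Module.length R (R ⧸ L) ≤ Module.length R (R ⧸ (K ⊔ Ideal.span {x})) :=
    length_quotient_mono (sup_le hKL ((Ideal.span_singleton_le_iff_mem _).2 hxL))
  have hnt : Nontrivial (R ⧸ K.colon {x}) := by
    refine Ideal.Quotient.nontrivial_iff.2 fun htop => hxK ?_
    simpa using (hmem 1).1 (htop ▸ trivial)
  have h3 : 1 ≤ Module.length R (R ⧸ K.colon {x}) :=
    Order.one_le_iff_pos.2 (Module.length_pos_iff.2 hnt)
  have h4 : Module.length R (R ⧸ L) + 1 ≤ Module.length R (R ⧸ L) := by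
    calc _ ≤ Module.length R (R ⧸ (K ⊔ Ideal.span {x})) +
        Module.length R (R ⧸ K.colon {x}) := add_le_add h2 h3
      _ = Module.length R (R ⧸ K) := by rw [h1, add_comm]
      _ ≤ _ := h
  exact absurd h4 (not_le.2 ((ENat.lt_add_one_iff hfin).2 le_rfl))

variable [IsLocalRing R]

theorem length_quotient_maximalIdeal : Module.length R (R ⧸ maximalIdeal R) = 1 := by
  have : IsSimpleModule R (R ⧸ maximalIdeal R) :=
    isSimpleModule_iff_isCoatom.2 (maximalIdeal.isMaximal R).out
  exact Module.length_eq_one R _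

theorem length_quotient_ne_top_of_pow_le [IsNoetherianRing R] {K : Ideal R} {N : ℕ}
    (h : maximalIdeal R ^ N ≤ K) : Module.length R (R ⧸ K) ≠ ⊤ := by
  induction K using IsNoetherian.induction (R := R) (M := R) with
  | hgt K ih =>
    by_cases hsoc : SocleFree K
    · have htop : ∀ n, maximalIdeal R ^ n ≤ K → K = ⊤ := by
        intro n
        induction n with
        | zero => intro h; simpa using h
        | succ n ih =>
          refine fun h => ih fun y hy => hsoc y fun c hc => h ?_
          rw [pow_succ']
          exact Ideal.mul_mem_mul hc hy
      have : Subsingleton (R ⧸ K) := Submodule.Quotient.subsingleton_iff.2 (htop N h)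
      simp
    · simp only [SocleFree, not_forall] at hsoc
      obtain ⟨x, hx, hxK⟩ := hsoc
      have hmem : ∀ y, y ∈ K.colon {x} ↔ x * y ∈ K := fun y => by
        rw [Submodule.mem_colon_singleton, smul_eq_mul, mul_comm]
      rw [length_quotient_eq_add hmem]
      refine WithTop.add_ne_top.2 ⟨ne_top_of_le_ne_top ENat.one_ne_top
        (length_quotient_maximalIdeal (R := R) ▸ length_quotient_mono fun c hc => ?_), ?_⟩
      · rw [hmem, mul_comm]; exact hx c hc
      · exact ih _ (left_lt_sup.2 fun hle => hxK ((Ideal.span_singleton_le_iff_mem _).1 hle))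
          (h.trans le_sup_left)

theorem length_quotient_maximalIdeal_sq [IsNoetherianRing R] :
    Module.length R (R ⧸ maximalIdeal R ^ 2) = (maximalIdeal R).spanFinrank + 1 := by
  have h1 : Module.length R (R ⧸ maximalIdeal R ^ 2) =
      Module.length R (CotangentSpace R) + Module.length R (R ⧸ maximalIdeal R) := by
    refine Module.length_eq_add_of_exact (maximalIdeal R).cotangentToQuotientSquare
      (Submodule.factor (Ideal.pow_le_self two_ne_zero))
      (maximalIdeal R).cotangentToQuotientSquare_injective (Submodule.factor_surjective _) ?_
    intro a
    obtain ⟨a, rfl⟩ := Submodule.mkQ_surjective _ a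
    constructor
    · intro ha
      exact ⟨(maximalIdeal R).toCotangent ⟨a, (Submodule.Quotient.mk_eq_zero _).1 ha⟩, rfl⟩
    · rintro ⟨y, hy⟩
      obtain ⟨y, rfl⟩ := (maximalIdeal R).toCotangent_surjective y
      rw [← hy]
      exact (Submodule.Quotient.mk_eq_zero _).2 y.2
  rw [h1, length_quotient_maximalIdeal, spanFinrank_maximalIdeal_eq_finrank_cotangentSpace,
    Module.length_eq_of_surjective (S := R) (R := ResidueField R) residue_surjective,
    Module.length_eq_finrank]

/-- A lower bound for the Hilbert function. For a superficial regular element `x` and large `n`, the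
lengths of `R ⧸ (J + 𝔪 ^ n)` have the lengths of `R ⧸ (J + (x) + 𝔪 ^ n)` as their differences, so a
bound by `e` times a binomial coefficient is carried over by Pascal's rule. -/
theorem SuperficialSequence.exists_choose_mul_le {I J : Ideal R} (hI : I ≤ maximalIdeal R)
    {n : ℕ} (h : SuperficialSequence I n J) {e : ℕ∞} {j : ℕ}
    (he : ∃ N, ∀ k, e * (k.choose j : ℕ) ≤ Module.length R (R ⧸ (J ⊔ maximalIdeal R ^ (k + N)))) :
    ∃ N, ∀ k, e * (k.choose (j + n) : ℕ) ≤ Module.length R (R ⧸ maximalIdeal R ^ (k + N)) := by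
  induction h generalizing j with
  | zero =>
    obtain ⟨N, hN⟩ := he
    exact ⟨N, fun k => (hN k).trans (length_quotient_mono le_sup_right)⟩
  | @succ n J x hJ hxI hreg hsup ih =>
    rw [show j + (n + 1) = j + 1 + n by ring]
    apply ih
    obtain ⟨N₁, h₁⟩ := he
    obtain ⟨N₂, h₂⟩ := hsup
    refine ⟨N₁ + N₂, fun k => ?_⟩
    induction k with
    | zero => simp
    | succ k ihk =>
      have hmem : ∀ y, y ∈ J ⊔ maximalIdeal R ^ (k + (N₁ + N₂)) ↔
          x * y ∈ J ⊔ maximalIdeal R ^ (k + 1 + (N₁ + N₂)) := by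
        intro y
        rw [show k + 1 + (N₁ + N₂) = k + (N₁ + N₂) + 1 by ring]
        refine ⟨fun hy => ?_, fun hy => h₂ _ (by omega) y hy⟩
        obtain ⟨u, hu, v, hv, rfl⟩ := Submodule.mem_sup.1 hy
        rw [mul_add, pow_succ']
        exact Submodule.add_mem_sup (J.mul_mem_left _ hu) (Ideal.mul_mem_mul (hI hxI) hv)
      have h3 := h₁ (k + 1 + N₂)
      rw [show k + 1 + N₂ + N₁ = k + 1 + (N₁ + N₂) by ring, sup_right_comm] at h3
      rw [length_quotient_eq_add hmem, Nat.choose_succ_succ', add_comm (k.choose j), Nat.cast_add,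
        mul_add]
      refine add_le_add ihk (le_trans ?_ h3)
      gcongr
      omega

/-- The inequality `ℓ(R ⧸ I) ≤ e(R)` for an ideal generated by a superficial regular sequence of
length `dim R`. -/
theorem length_quotient_le_of_hasMultiplicity [IsNoetherianRing R] {I : Ideal R}
    (hI : I ≤ maximalIdeal R) {d e : ℕ} (hd : ringKrullDim R = d)
    (h : SuperficialSequence I d I) (he : HasMultiplicity R e) :
    Module.length R (R ⧸ I) ≤ e := by
  obtain ⟨d', hd', hlim⟩ := he
  obtain rfl : d = d' := by exact_mod_cast hd.symm.trans hd'
  obtain ⟨N₀, hN₀⟩ := h.exists_pow_le hd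
  obtain ⟨a, ha⟩ := ENat.ne_top_iff_exists.1 (length_quotient_ne_top_of_pow_le hN₀)
  obtain ⟨N, hN⟩ := h.exists_choose_mul_le hI (e := a) (j := 0) ⟨N₀, fun k => by
    rw [sup_eq_left.2 ((Ideal.pow_le_pow_right (by omega)).trans hN₀), ← ha]
    simp⟩
  rw [← ha]
  rw [zero_add] at hN
  have hle : ∀ k, a * (k + 1) ^ d ≤ d.factorial *
      (Module.length R (R ⧸ maximalIdeal R ^ (k + d + N))).toNat := by
    intro k
    have hfin : Module.length R (R ⧸ maximalIdeal R ^ (k + d + N)) ≠ ⊤ :=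
      length_quotient_ne_top_of_pow_le le_rfl
    have h1 := hN (k + d)
    rw [← ENat.natCast_toNat hfin] at h1
    have h2 : a * (k + d).choose d ≤
      (Module.length R (R ⧸ maximalIdeal R ^ (k + d + N))).toNat := by exact_mod_cast h1
    have h3 := Nat.pow_sub_le_descFactorial (k + d) d
    rw [show k + d + 1 - d = k + 1 by omega, Nat.descFactorial_eq_factorial_mul_choose] at h3
    calc a * (k + 1) ^ d ≤ a * (d.factorial * (k + d).choose d) := Nat.mul_le_mul_left _ h3
      _ = d.factorial * (a * (k + d).choose d) := by ring
      _ ≤ _ := Nat.mul_le_mul_left _ h2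
  -- Comparison of `a (k + 1) ^ d / (k + d + N) ^ d`, which tends to `a`, with the sequence defining
  -- the multiplicity, shifted by `d + N`.
  have hlim' := hlim.comp (tendsto_add_atTop_nat (d + N))
  have hlow : Tendsto (fun k : ℕ => (a : ℝ) * (((1 : ℝ) + 1 * k) / (((d + N : ℕ) : ℝ) + 1 * k)) ^ d)
      atTop (𝓝 (a : ℝ)) := by
    simpa using ((tendsto_add_mul_div_add_mul_atTop_nhds (1 : ℝ) ((d + N : ℕ) : ℝ) 1
      one_ne_zero).pow d).const_mul (a : ℝ)
  have hae : (a : ℝ) ≤ e := by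
    refine le_of_tendsto_of_tendsto' hlow hlim' fun k => ?_
    simp only [Function.comp_apply]
    rw [div_pow, ← mul_div_assoc,
      show ((d + N : ℕ) : ℝ) + 1 * k = ((k + (d + N) : ℕ) : ℝ) by push_cast; ring]
    refine div_le_div_of_nonneg_right ?_ (by positivity)
    rw [← add_assoc k d N, one_mul, add_comm (1 : ℝ)]
    exact_mod_cast hle k
  exact_mod_cast hae

/-- Adding one generator `x ∈ I` to an ideal containing `I 𝔪` changes the colength by at most one,
since `𝔪 x` is already contained in it. With `K = I 𝔪` this bounds the length of `I ⧸ I 𝔪`. -/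
theorem SuperficialSequence.length_quotient_le_add {I J K : Ideal R} {n : ℕ}
    (h : SuperficialSequence I n J) (hK : I * maximalIdeal R ≤ K) :
    Module.length R (R ⧸ K) ≤ Module.length R (R ⧸ (K ⊔ J)) + n := by
  induction h with
  | zero => simpa using length_quotient_mono (sup_le le_rfl bot_le)
  | @succ n J x hJ hxI hreg hsup ih =>
    have hmem : ∀ y, y ∈ (K ⊔ J).colon {x} ↔ x * y ∈ K ⊔ J := fun y => by
      rw [Submodule.mem_colon_singleton, smul_eq_mul, mul_comm]
    have h1 : Module.length R (R ⧸ (K ⊔ J).colon {x}) ≤ 1 := by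
      rw [← length_quotient_maximalIdeal (R := R)]
      refine length_quotient_mono fun c hc => ?_
      rw [hmem]
      exact Ideal.mem_sup_left (hK (Ideal.mul_mem_mul hxI hc))
    calc Module.length R (R ⧸ K) ≤ Module.length R (R ⧸ (K ⊔ J)) + n := ih
      _ ≤ 1 + Module.length R (R ⧸ (K ⊔ J ⊔ Ideal.span {x})) + n := by
        rw [length_quotient_eq_add hmem]
        gcongr
      _ = _ := by rw [sup_assoc]; push_cast; ring

/-- In minimal multiplicity, `ℓ(R ⧸ I 𝔪) ≤ ℓ(R ⧸ I) + d ≤ e + d = μ(𝔪) + 1 = ℓ(R ⧸ 𝔪 ^ 2)`, and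
`I 𝔪 ⊆ 𝔪 ^ 2` forces equality. -/
theorem mul_maximalIdeal_eq_sq [IsNoetherianRing R] {I : Ideal R} (hI : I ≤ maximalIdeal R)
    {d e : ℕ} (hd : ringKrullDim R = d) (h : SuperficialSequence I d I)
    (he : HasMultiplicity R e) (hmin : e + d = (maximalIdeal R).spanFinrank + 1) :
    I * maximalIdeal R = maximalIdeal R ^ 2 := by
  refine eq_of_length_quotient_le (by rw [pow_two]; exact Ideal.mul_mono_left hI)
    (length_quotient_ne_top_of_pow_le le_rfl) ?_
  calc Module.length R (R ⧸ (I * maximalIdeal R))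
      ≤ Module.length R (R ⧸ (I * maximalIdeal R ⊔ I)) + d := h.length_quotient_le_add le_rfl
    _ = Module.length R (R ⧸ I) + d := by rw [sup_eq_right.2 Ideal.mul_le_left]
    _ ≤ e + d := by gcongr; exact length_quotient_le_of_hasMultiplicity hI hd h he
    _ = _ := by rw [length_quotient_maximalIdeal_sq]; exact_mod_cast hmin

end Length

/-! ### Descent of the Valabrega–Valla condition, and colon ideals of powers -/

section ValabregaValla

variable {R : Type*} [CommRing R] [IsLocalRing R]

/-- The condition `J ∩ 𝔪 ^ (n + 1) ⊆ J 𝔪 ^ n` for all `n` descends from `(J, x)` to `J` when `x` is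
regular modulo `J`. -/
theorem RegularModulo.inf_pow_le {J : Ideal R} {x : R} (hx : RegularModulo J x)
    (h : ∀ n, (J ⊔ Ideal.span {x}) ⊓ maximalIdeal R ^ (n + 1) ≤
      (J ⊔ Ideal.span {x}) * maximalIdeal R ^ n) (hxm : x ∈ maximalIdeal R) (n : ℕ) :
    J ⊓ maximalIdeal R ^ (n + 1) ≤ J * maximalIdeal R ^ n := by
  induction n with
  | zero => simp
  | succ n ih =>
    intro u ⟨huJ, hum⟩
    have hu := h (n + 1) ⟨Ideal.mem_sup_left huJ, hum⟩
    rw [Ideal.sup_mul] at hu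
    obtain ⟨v, hv, t, ht, rfl⟩ := Submodule.mem_sup.1 hu
    obtain ⟨w, hw, rfl⟩ := Ideal.mem_span_singleton_mul.1 ht
    have hwJ : w ∈ J := hx w (((J.add_mem_iff_right (Ideal.mul_le_left hv)).1 huJ))
    refine add_mem hv ?_
    have := Ideal.mul_mem_mul hxm (ih ⟨hwJ, hw⟩)
    rwa [mul_left_comm, ← pow_succ'] at this

/-- The element found is the first term of the sequence, to which the condition on `J` descends;
for a principal ideal generated by a regular element the condition says `𝔪 ^ (n + 1) : x = 𝔪 ^ n`.
-/
theorem SuperficialSequence.exists_mem_forall_mem_pow {I J : Ideal R}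
    (hI : I ≤ maximalIdeal R) {d : ℕ} (hd : d ≠ 0) (h : SuperficialSequence I d J)
    (hJ : ∀ n, J ⊓ maximalIdeal R ^ (n + 1) ≤ J * maximalIdeal R ^ n) :
    ∃ x ∈ maximalIdeal R, ∀ n y, x * y ∈ maximalIdeal R ^ (n + 1) → y ∈ maximalIdeal R ^ n := by
  induction h with
  | zero => exact absurd rfl hd
  | @succ n J x hJs hxI hreg hsup ih =>
    by_cases hn : n = 0
    · subst hn
      cases hJs
      rw [bot_sup_eq] at hJ
      refine ⟨x, hI hxI, fun n y hy => ?_⟩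
      obtain ⟨z, hz, e⟩ := Ideal.mem_span_singleton_mul.1
        (hJ n ⟨Ideal.mul_mem_right _ _ (Ideal.mem_span_singleton_self x), hy⟩)
      have : z - y ∈ (⊥ : Ideal R) := hreg _ (by rw [mul_sub, e, sub_self]; exact zero_mem _)
      rwa [← sub_eq_zero.1 ((Submodule.mem_bot R).1 this)]
    · exact ih hn (hreg.inf_pow_le hJ (hI hxI))

theorem inf_pow_le_of_mul_eq_sq {I : Ideal R} (h : I * maximalIdeal R = maximalIdeal R ^ 2)
    (n : ℕ) : I ⊓ maximalIdeal R ^ (n + 1) ≤ I * maximalIdeal R ^ n := by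
  cases n with
  | zero => simp
  | succ n =>
    refine inf_le_right.trans ?_
    rw [pow_succ' _ n, ← mul_assoc, h, ← pow_add, add_comm 2]

theorem colon_pow_succ_eq {x : R} (hxm : x ∈ maximalIdeal R)
    (hx : ∀ n y, x * y ∈ maximalIdeal R ^ (n + 1) → y ∈ maximalIdeal R ^ n) (n : ℕ) :
    (maximalIdeal R ^ (n + 1)).colon (maximalIdeal R : Set R) = maximalIdeal R ^ n := by
  ext y
  rw [Submodule.mem_colon]
  refine ⟨fun h => hx n y ?_, fun h c hc => ?_⟩
  · rw [mul_comm]; exact h x hxm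
  · rw [pow_succ]; exact Ideal.mul_mem_mul h hc

/-- Both sets contain every positive integer, and `0` belongs to either of them exactly when
`I = 𝔪`. -/
theorem thirdDaoSet_eq {I : Ideal R}
    (h : I * maximalIdeal R = maximalIdeal R ^ 2)
    (hcolon : ∀ n, (maximalIdeal R ^ (n + 1)).colon (maximalIdeal R : Set R) = maximalIdeal R ^ n) :
    thirdDaoSet I = {m : ℕ | I * maximalIdeal R ^ m = maximalIdeal R ^ (m + 1)} := by
  have hpow : ∀ m, m ≠ 0 → I * maximalIdeal R ^ m = maximalIdeal R ^ (m + 1) := by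
    intro m hm
    obtain ⟨m, rfl⟩ := Nat.exists_eq_succ_of_ne_zero hm
    rw [Nat.succ_eq_add_one, pow_succ' _ m, ← mul_assoc, h, ← pow_add]
    congr 1
    omega
  have hfull : ∀ m, I * maximalIdeal R ^ m = maximalIdeal R ^ (m + 1) →
      IsWeaklyFull (I * maximalIdeal R ^ m) := by
    intro m hm
    rw [IsWeaklyFull, hm, ← pow_succ, hcolon]
  ext t
  constructor
  · intro ht
    by_cases h0 : t = 0
    · subst h0
      have h1 : IsWeaklyFull (I * maximalIdeal R ^ 0) := ht 0 le_rfl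
      rw [pow_zero, mul_one, IsWeaklyFull, h] at h1
      rw [Set.mem_ofPred_eq, pow_zero, mul_one, zero_add, ← h1, hcolon 1]
    · exact hpow t h0
  · intro ht k hk
    by_cases h0 : k = 0
    · subst h0
      rw [Nat.le_zero.1 hk] at ht
      exact hfull 0 ht
    · exact hfull k (hpow k h0)

end ValabregaValla

end DaoNumbers

theorem mainTheorem6 {R : Type*} [CommRing R] [IsLocalRing R]
    (hCM : DaoNumbers.IsCohenMacaulayLocal R)
    (hK : Infinite (IsLocalRing.ResidueField R))
    (hdim : 2 ≤ ringKrullDim R)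
    (hmin : DaoNumbers.HasMinimalMultiplicity R)
    (I : Ideal R)
    (hI : DaoNumbers.IsMinimalReduction I (IsLocalRing.maximalIdeal R)) :
    (DaoNumbers.thirdDaoSet I).Nonempty ∧
      DaoNumbers.thirdDaoNumber I =
        DaoNumbers.reductionNumber I (IsLocalRing.maximalIdeal R) := by
  obtain ⟨hnoeth, hdepth⟩ := hCM
  obtain ⟨d, e, hd, he, hed⟩ := hmin
  have hd0 : d ≠ 0 := by
    rintro rfl
    rw [hd] at hdim
    exact absurd hdim (by decide)
  have hD : DaoNumbers.DepthAtLeast d (⊥ : Ideal R) :=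
    DaoNumbers.depthAtLeast_of_le_depth (by rw [hd] at hdepth; exact_mod_cast hdepth.ge)
  have hIm := hI.1.1
  have hseq := hI.superficialSequence hd hD
  have hsq := DaoNumbers.mul_maximalIdeal_eq_sq hIm hd hseq he hed
  obtain ⟨x, hxm, hx⟩ := hseq.exists_mem_forall_mem_pow hIm hd0
    (DaoNumbers.inf_pow_le_of_mul_eq_sq hsq)
  have hset := DaoNumbers.thirdDaoSet_eq hsq (DaoNumbers.colon_pow_succ_eq hxm hx)
  refine ⟨⟨1, ?_⟩, by rw [DaoNumbers.thirdDaoNumber, hset, DaoNumbers.reductionNumber]⟩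
  rw [hset, Set.mem_ofPred_eq, pow_one, hsq]
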